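/- **Theorem.** Willow tree forcing $\mathbb{W}$ is $\omega^\omega$-bounding. Here a *willow tree* is given by a pair $(f,A)$, where $A$ is an infinite set of pairwise disjoint nonempty finite subsets of $\omega$ and $f:\omega\setminus\bigcup A\to 2$ is a function; its branches are the $x\in 2^\omega$ that extend $f$ and are constant on every $a\in A$, and the tree itself is the set of finite initial segments of its branches. $\mathbb{W}$ is the set of all willow trees, ordered by inclusion of trees; equivalently, $(g,B)\le(f,A)$ if and only if $f\subseteq g$, every $b\in B$ is a union of elements of $A$, and $g$ is constant on every $a\in A$ with $a\subseteq\operatorname{dom}(g)$. That $\mathbb{W}$ is $\omega^\omega$-bounding means: for every condition $p\in\mathbb{W}$ and every $\mathbb{W}$-name $\dot x$ with $p\Vdash\dot x\in\omega^\omega$, there are a condition $q\le p$ and a function $g\in\omega^\omega$ in the ground model such that $q\Vdash\dot x<^*\check g$, that is, $q\Vdash\exists m\in\omega\;\forall n\ge m\;\bigl(\dot x(n)<\check g(n)\bigr)$. -/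

import Mathlib

/-! ## Forcing over a partial order: names, the forcing relation, `ω^ω`-bounding

The ground model is the universe of (pre)sets `PSet.{0}`, so that the elements of `ω^ω` in the ground
model are the functions `ℕ → ℕ`. -/

namespace Forcing

/-- `P`-names: a name is a set-indexed family of pairs (name, condition). -/
inductive Name (P : Type) : Type 1
  | mk (ι : Type) (elt : ι → Name P) (cond : ι → P) : Name P

section Language

variable {P : Type} [Preorder P]

/-- `eq σ τ p` means `p ⊩ σ = τ`: whenever a condition `q ≤ p` puts an element of `σ` into `σ`, then
densely often below `q` this element is forced to be equal to an element of `τ`, and vice versa. -/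
def eq : Name P → Name P → P → Prop
  | .mk ι a s, .mk κ b t => fun p =>
    (∀ i : ι, ∀ q ≤ p, q ≤ s i → ∃ r ≤ q, ∃ j : κ, r ≤ t j ∧ eq (a i) (b j) r) ∧
    (∀ j : κ, ∀ q ≤ p, q ≤ t j → ∃ r ≤ q, ∃ i : ι, r ≤ s i ∧ eq (a i) (b j) r)

/-- `mem σ τ p` means `p ⊩ σ ∈ τ`. -/
def mem (σ : Name P) : Name P → P → Prop
  | .mk κ b t => fun p => ∀ q ≤ p, ∃ r ≤ q, ∃ j : κ, r ≤ t j ∧ eq σ (b j) r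

/-! A statement `φ` of the forcing language is given by the predicate `φ p`, "`p ⊩ φ`".
The clauses below are the usual recursive clauses of the forcing relation; quantifiers range over
all names. -/

/-- `p ⊩ φ ∧ ψ`. -/
def and (φ ψ : P → Prop) : P → Prop := fun p => φ p ∧ ψ p

/-- `p ⊩ φ ∨ ψ`. -/
def or (φ ψ : P → Prop) : P → Prop := fun p => ∀ q ≤ p, ∃ r ≤ q, φ r ∨ ψ r

/-- `p ⊩ φ → ψ`: no `q ≤ p` forces both `φ` and the negation of `ψ`. -/
def imp (φ ψ : P → Prop) : P → Prop := fun p => ∀ q ≤ p, φ q → ∃ r ≤ q, ψ r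

/-- `p ⊩ ∀ x, φ x`. -/
def all (φ : Name P → P → Prop) : P → Prop := fun p => ∀ σ, φ σ p

/-- `p ⊩ ∃ x, φ x`. -/
def ex (φ : Name P → P → Prop) : P → Prop := fun p => ∀ q ≤ p, ∃ r ≤ q, ∃ σ, φ σ r

/-- `p ⊩ ∀ x ∈ τ, φ x`. -/
def allIn (τ : Name P) (φ : Name P → P → Prop) : P → Prop := all fun σ => imp (mem σ τ) (φ σ)

/-- `p ⊩ ∃ x ∈ τ, φ x`. -/
def exIn (τ : Name P) (φ : Name P → P → Prop) : P → Prop := ex fun σ => and (mem σ τ) (φ σ)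

end Language

section CanonicalNames

variable {P : Type} [Preorder P] [OrderTop P]

/-- The canonical name `x̌` of a ground model set `x`. -/
def check : PSet.{0} → Name P
  | .mk α A => .mk α (fun a => check (A a)) (fun _ => ⊤)

/-- The canonical name of the unordered pair of `σ` and `τ`. -/
def upair (σ τ : Name P) : Name P := .mk Bool (fun b => cond b σ τ) (fun _ => ⊤)

/-- The canonical name of the (Kuratowski) ordered pair of `σ` and `τ`. -/
def opair (σ τ : Name P) : Name P := upair (upair σ σ) (upair σ τ)

/-- The canonical name of the set `ω`. -/
def omega : Name P := check PSet.omega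

/-- The graph of a function `g : ℕ → ℕ`, as a ground model set of Kuratowski pairs. -/
def graph (g : ℕ → ℕ) : PSet.{0} :=
  .mk ℕ fun n => {{PSet.ofNat n}, {PSet.ofNat n, PSet.ofNat (g n)}}

/-- The statement "`x` is a function from `ω` to `ω`". -/
def isReal (x : Name P) : P → Prop :=
  and (allIn x fun z => exIn omega fun n => exIn omega fun k => eq z (opair n k))
    (allIn omega fun n =>
      and (exIn omega fun k => mem (opair n k) x)
        (allIn omega fun k => allIn omega fun l =>
          imp (and (mem (opair n k) x) (mem (opair n l) x)) (eq k l)))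

/-- The statement "`x <* y`" for `x, y ∈ ω^ω`: there is `m ∈ ω` such that `x(n) < y(n)` for all
`n ≥ m`. The order of `ω` is membership. -/
def eventuallyLt (x y : Name P) : P → Prop :=
  exIn omega fun m => allIn omega fun n =>
    imp (or (mem m n) (eq m n))
      (allIn omega fun k => allIn omega fun l =>
        imp (and (mem (opair n k) x) (mem (opair n l) y)) (mem k l))

end CanonicalNames

/-- `P` is `ω^ω`-bounding: for every name `x` for a real in `ω^ω`, below every condition there is one
that forces `x` to be eventually dominated by some function `g` of the ground model. -/
def OmegaOmegaBounding (P : Type) [Preorder P] [OrderTop P] : Prop :=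
  ∀ (p : P) (x : Name P), isReal x p → ∃ q ≤ p, ∃ g : ℕ → ℕ, eventuallyLt x (check (graph g)) q

end Forcing

/-! ## Willow tree forcing -/

/-- A willow tree, coded by a pair `(f, A)`: `A` is an infinite set of pairwise disjoint nonempty finite
subsets of `ω`, and `f : ω \ ⋃ A → 2`. Here `val n = some (f n)` if `n ∈ dom f`, and `val n = none`
if `n ∈ ⋃ A`. -/
structure WillowTree where
  blocks : Set (Finset ℕ)
  infinite_blocks : blocks.Infinite
  nonempty_of_mem : ∀ a ∈ blocks, a.Nonempty
  disjoint_blocks : blocks.PairwiseDisjoint id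
  val : ℕ → Option Bool
  val_eq_none_iff : ∀ n, val n = none ↔ ∃ a ∈ blocks, n ∈ a

namespace WillowTree

/-- The branches of the willow tree: all `x ∈ 2^ω` that extend `f` and are constant on each
block in `A`. -/
def branches (p : WillowTree) : Set (ℕ → Bool) :=
  {x | (∀ n b, p.val n = some b → x n = b) ∧ ∀ a ∈ p.blocks, ∀ m ∈ a, ∀ n ∈ a, x m = x n}

/-- The tree itself: the finite initial segments of the branches. -/
def tree (p : WillowTree) : Set (List Bool) :=
  {s | ∃ x ∈ p.branches, ∃ n : ℕ, s = (List.range n).map x}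

/-- `(g, B) ≤ (f, A)`: `g` extends `f`, every block in `B` is a union of blocks in `A`, and each block
in `A` that is contained in `dom g` is one on which `g` is constant (a block in `A` that is not
contained in `dom g` is contained in a block in `B`, where `val` is `none`).
Equivalently, the tree of `(g, B)` is a subtree of that of `(f, A)`, see `le_iff_tree_subset`. -/
instance : LE WillowTree where
  le q p :=
    (∀ n b, p.val n = some b → q.val n = some b) ∧
    (∀ a ∈ q.blocks, ∃ C ⊆ p.blocks, (a : Set ℕ) = ⋃ c ∈ C, (c : Set ℕ)) ∧
    (∀ a ∈ p.blocks, ∀ m ∈ a, ∀ n ∈ a, q.val m = q.val n)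


open Classical in
/-- The branch that is constantly `1` on the blocks in `S` and `0` on all other blocks. -/
noncomputable def branchOf (q : WillowTree) (S : Set (Finset ℕ)) (n : ℕ) : Bool :=
  (q.val n).getD (decide (∃ c ∈ S, n ∈ c))

theorem branchOf_mem (q : WillowTree) {S : Set (Finset ℕ)} (hS : S ⊆ q.blocks) :
    q.branchOf S ∈ q.branches := by
  refine ⟨fun n b h => by simp [branchOf, h], fun a ha m hm n hn => ?_⟩
  have key : ∀ k ∈ a, (∃ c ∈ S, k ∈ c) ↔ a ∈ S := by
    refine fun k hk => ⟨?_, fun h => ⟨a, h, hk⟩⟩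
    rintro ⟨c, hc, hkc⟩
    by_contra hne
    have hac : a ≠ c := by rintro rfl; exact hne hc
    exact Finset.disjoint_left.1 (q.disjoint_blocks ha (hS hc) hac) hk hkc
  have h1 := (q.val_eq_none_iff m).2 ⟨a, ha, hm⟩
  have h2 := (q.val_eq_none_iff n).2 ⟨a, ha, hn⟩
  rw [branchOf, branchOf, h1, h2, Option.getD_none, Option.getD_none]
  exact decide_eq_decide.2 ((key m hm).trans (key n hn).symm)

theorem le_iff_branches_subset {q p : WillowTree} : q ≤ p ↔ q.branches ⊆ p.branches := by
  constructor
  · rintro ⟨h1, h2, h3⟩ x ⟨hx1, hx2⟩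
    refine ⟨fun n b h => hx1 n b (h1 n b h), fun a ha m hm n hn => ?_⟩
    cases hv : q.val m with
    | some b => rw [hx1 m b hv, hx1 n b ((h3 a ha m hm n hn) ▸ hv)]
    | none =>
      have hv' : q.val n = none := (h3 a ha m hm n hn) ▸ hv
      obtain ⟨c, hc, hmc⟩ := (q.val_eq_none_iff m).1 hv
      obtain ⟨C, hC, hcC⟩ := h2 c hc
      have hm' : m ∈ ⋃ c ∈ C, (c : Set ℕ) := hcC ▸ (show m ∈ (c : Set ℕ) from hmc)
      simp only [Set.mem_iUnion, Finset.mem_coe] at hm'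
      obtain ⟨a', ha', hma'⟩ := hm'
      have : a' = a := by
        by_contra hne
        exact Finset.disjoint_left.1 (p.disjoint_blocks (hC ha') ha hne) hma' hm
      subst this
      have hn' : n ∈ (c : Set ℕ) := by
        rw [hcC]
        exact Set.mem_biUnion ha' hn
      exact hx2 c hc m hmc n hn'
  · intro h
    have hz := h (q.branchOf_mem (S := ∅) (by simp))
    have hy : ∀ c ∈ q.blocks, q.branchOf {c} ∈ p.branches := fun c hc =>
      h (q.branchOf_mem (by simpa using hc))
    have hfree : ∀ n, ∀ c ∈ q.blocks, n ∈ c → q.branchOf {c} n = true ∧ q.branchOf ∅ n = false := by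
      intro n c hc hn
      simp [branchOf, (q.val_eq_none_iff n).2 ⟨c, hc, hn⟩, hn]
    have hback : ∀ n, ∀ c ∈ q.blocks, q.branchOf {c} n = true → q.branchOf ∅ n = false → n ∈ c := by
      intro n c hc h1 h2
      cases hv : q.val n with
      | some b => simp [branchOf, hv] at h1 h2; simp [h1] at h2
      | none => simpa [branchOf, hv] using h1
    have hstep : ∀ a ∈ p.blocks, ∀ m ∈ a, ∀ c ∈ q.blocks, m ∈ c → ∀ n ∈ a, n ∈ c := by
      intro a ha m hm c hc hmc n hn
      obtain ⟨h1, h2⟩ := hfree m c hc hmc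
      exact hback n c hc (by rw [← (hy c hc).2 a ha m hm n hn, h1])
        (by rw [← hz.2 a ha m hm n hn, h2])
    have hval : ∀ n b, p.val n = some b → q.val n = some b := by
      intro n b hb
      cases hv : q.val n with
      | some b' => rw [← hz.1 n b hb]; simp [branchOf, hv]
      | none =>
        obtain ⟨c, hc, hn⟩ := (q.val_eq_none_iff n).1 hv
        obtain ⟨h1, h2⟩ := hfree n c hc hn
        have e1 := hz.1 n b hb
        have e2 := (hy c hc).1 n b hb
        rw [h1] at e2; rw [h2] at e1
        exact absurd (e1.trans e2.symm) (by simp)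
    refine ⟨hval, fun c hc => ⟨{a | a ∈ p.blocks ∧ a ⊆ c}, fun a ha => ha.1, ?_⟩, ?_⟩
    · ext m
      simp only [Finset.mem_coe, Set.mem_ofPred_eq, Set.mem_iUnion, exists_prop]
      refine ⟨fun hm => ?_, fun ⟨a, ha, hma⟩ => ha.2 hma⟩
      have hpm : p.val m = none := by
        cases hv : p.val m with
        | none => rfl
        | some b =>
          have := hval m b hv
          rw [(q.val_eq_none_iff m).2 ⟨c, hc, hm⟩] at this
          exact absurd this (by simp)
      obtain ⟨a, ha, hma⟩ := (p.val_eq_none_iff m).1 hpm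
      exact ⟨a, ⟨ha, fun n hn => hstep a ha m hma c hc hm n hn⟩, hma⟩
    · intro a ha m hm n hn
      have hnone : ∀ m ∈ a, ∀ n ∈ a, q.val m = none → q.val n = none := by
        intro m hm n hn hv
        obtain ⟨c, hc, hmc⟩ := (q.val_eq_none_iff m).1 hv
        exact (q.val_eq_none_iff n).2 ⟨c, hc, hstep a ha m hm c hc hmc n hn⟩
      have e := hz.2 a ha m hm n hn
      cases hv : q.val m with
      | none => exact (hnone m hm n hn hv).symm
      | some b =>
        cases hv' : q.val n with
        | none => rw [hnone n hn m hm hv'] at hv; exact absurd hv (by simp)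
        | some b' => simpa [branchOf, hv, hv'] using e

theorem le_iff_tree_subset {q p : WillowTree} : q ≤ p ↔ q.tree ⊆ p.tree := by
  rw [le_iff_branches_subset]
  constructor
  · rintro h s ⟨x, hx, n, rfl⟩
    exact ⟨x, h hx, n, rfl⟩
  · intro h x hx
    have key : ∀ N, ∃ y ∈ p.branches, ∀ k < N, x k = y k := by
      intro N
      obtain ⟨y, hy, n, hn⟩ := h ⟨x, hx, N, rfl⟩
      have hNn : N = n := by simpa using congrArg List.length hn
      subst hNn
      exact ⟨y, hy, fun k hk => List.map_inj_left.1 hn k (List.mem_range.2 hk)⟩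
    constructor
    · intro n b hb
      obtain ⟨y, hy, hxy⟩ := key (n + 1)
      rw [hxy n (by omega), hy.1 n b hb]
    · intro a ha m hm n hn
      obtain ⟨y, hy, hxy⟩ := key (m + n + 1)
      rw [hxy m (by omega), hxy n (by omega), hy.2 a ha m hm n hn]

instance : Preorder WillowTree where
  le_refl _ := le_iff_branches_subset.2 subset_rfl
  le_trans _ _ _ h1 h2 := le_iff_branches_subset.2
    ((le_iff_branches_subset.1 h1).trans (le_iff_branches_subset.1 h2))

/-- The largest condition: `f = ∅` and all blocks are singletons; its tree is `2^{<ω}`. -/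
instance : OrderTop WillowTree where
  top :=
    { blocks := Set.range fun n : ℕ => {n}
      infinite_blocks := Set.infinite_range_of_injective Finset.singleton_injective
      nonempty_of_mem := by rintro _ ⟨n, rfl⟩; simp
      disjoint_blocks := by
        rintro _ ⟨m, rfl⟩ _ ⟨n, rfl⟩ h
        have : m ≠ n := fun e => h (by rw [e])
        exact Finset.disjoint_singleton.2 this
      val := fun _ => none
      val_eq_none_iff := by simp }
  le_top p := by
    refine le_iff_branches_subset.2 fun x _ => ⟨by simp, ?_⟩
    rintro _ ⟨k, rfl⟩ m hm n hn
    rw [Finset.mem_singleton.1 hm, Finset.mem_singleton.1 hn]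

end WillowTree

/-! This is a fusion argument. Let `F` be a finite set of blocks of `p`. Each of the finitely many
choices `S ⊆ F` of values on `F` yields `p.fix F S`, and these conditions are predense below `p`
(`exists_le_fix`). A condition below `p.fix F S` can have the blocks of `F` released again, giving a
condition below `p` that keeps them (`exists_fix_le`). Treating all `S` in turn gives `q ≤ p` that
keeps `F` and has finitely many candidates for the `n`-th value of the name, hence a bound
(`exists_forall_fix`). Iterate over `n` while `F` grows strictly: the kept blocks form an infinite
set, and every point is eventually either fixed or in a kept block. So the sequence has a lower
bound (`exists_fusion`), which forces all the bounds at once. The rest derives from the recursive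
clauses of forcing that names for reals have densely decided, unique values. -/

namespace Forcing

/-! ### Monotonicity and equality laws of the forcing relation -/

section Language

variable {P : Type} [Preorder P]

theorem eq_mono {σ τ : Name P} {p q : P} (hq : q ≤ p) (h : eq σ τ p) : eq σ τ q := by
  cases σ; cases τ
  rw [eq] at h ⊢
  exact ⟨fun i r hr => h.1 i r (hr.trans hq), fun j r hr => h.2 j r (hr.trans hq)⟩

theorem mem_mono {σ τ : Name P} {p q : P} (hq : q ≤ p) (h : mem σ τ p) : mem σ τ q := by
  cases τ
  rw [mem] at h ⊢
  exact fun r hr => h r (hr.trans hq)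

theorem eq_refl (σ : Name P) (p : P) : eq σ σ p := by
  induction σ generalizing p with
  | mk ι a s ih =>
    rw [eq]
    exact ⟨fun i q _ hs => ⟨q, le_rfl, i, hs, ih i q⟩, fun i q _ hs => ⟨q, le_rfl, i, hs, ih i q⟩⟩

theorem eq_symm {σ τ : Name P} {p : P} (h : eq σ τ p) : eq τ σ p := by
  induction σ generalizing τ p with
  | mk ι a s ih =>
    cases τ with
    | mk κ b t =>
      rw [eq] at h ⊢
      refine ⟨fun j q hq ht => ?_, fun i q hq hs => ?_⟩
      · obtain ⟨r, hr, i, hi, e⟩ := h.2 j q hq ht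
        exact ⟨r, hr, i, hi, ih i e⟩
      · obtain ⟨r, hr, j, hj, e⟩ := h.1 i q hq hs
        exact ⟨r, hr, j, hj, ih i e⟩

theorem eq_trans {σ τ ρ : Name P} {p : P} (h : eq σ τ p) (h' : eq τ ρ p) : eq σ ρ p := by
  induction σ generalizing τ ρ p with
  | mk ι a s ih =>
    obtain ⟨κ, b, t⟩ := τ
    obtain ⟨l, c, u⟩ := ρ
    rw [eq] at h h' ⊢
    refine ⟨fun i q hq hs => ?_, fun k q hq hu => ?_⟩
    · obtain ⟨r, hr, j, hj, e⟩ := h.1 i q hq hs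
      obtain ⟨r', hr', k, hk, e'⟩ := h'.1 j r (hr.trans hq) hj
      exact ⟨r', hr'.trans hr, k, hk, ih i (eq_mono hr' e) e'⟩
    · obtain ⟨r, hr, j, hj, e⟩ := h'.2 k q hq hu
      obtain ⟨r', hr', i, hi, e'⟩ := h.2 j r (hr.trans hq) hj
      exact ⟨r', hr'.trans hr, i, hi, ih i e' (eq_mono hr' e)⟩

theorem mem_congr_left {σ σ' τ : Name P} {p : P} (h : eq σ σ' p) (hm : mem σ τ p) :
    mem σ' τ p := by
  cases τ
  rw [mem] at hm ⊢
  intro q hq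
  obtain ⟨r, hr, j, hj, e⟩ := hm q hq
  exact ⟨r, hr, j, hj, eq_trans (eq_symm (eq_mono (hr.trans hq) h)) e⟩

theorem mem_congr_right {σ τ τ' : Name P} {p : P} (h : eq τ τ' p) (hm : mem σ τ p) :
    mem σ τ' p := by
  obtain ⟨κ, b, t⟩ := τ
  obtain ⟨l, c, u⟩ := τ'
  rw [eq] at h
  rw [mem] at hm ⊢
  intro q hq
  obtain ⟨r, hr, j, hj, e⟩ := hm q hq
  obtain ⟨r', hr', k, hk, e'⟩ := h.1 j r (hr.trans hq) hj
  exact ⟨r', hr'.trans hr, k, hk, eq_trans (eq_mono hr' e) e'⟩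

end Language

/-! ### Canonical names of numbers, pairs and graphs -/

section CanonicalNames

variable {P : Type} [Preorder P] [OrderTop P]

theorem check_mem_check {x y : PSet.{0}} (h : x ∈ y) (p : P) : mem (check x) (check y) p := by
  -- Membership in a `PSet` is only up to extensional equivalence, which `check` must therefore
  -- respect.
  have key : ∀ (x y : PSet.{0}), PSet.Equiv x y → ∀ p : P, eq (check x) (check y) p := by
    intro x
    induction x with
    | mk α A ih =>
      rintro ⟨β, B⟩ e p
      rw [check, check, eq]
      refine ⟨fun i q _ _ => ?_, fun j q _ _ => ?_⟩
      · obtain ⟨j, hj⟩ := e.1 i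
        exact ⟨q, le_rfl, j, le_top, ih i _ hj q⟩
      · obtain ⟨i, hi⟩ := e.2 j
        exact ⟨q, le_rfl, i, le_top, ih i _ hi q⟩
  obtain ⟨β, B⟩ := y
  obtain ⟨j, hj⟩ := h
  rw [check, mem]
  exact fun q _ => ⟨q, le_rfl, j, le_top, key _ _ hj q⟩

theorem check_ofNat_mem_omega (n : ℕ) (p : P) : mem (check (PSet.ofNat n)) omega p :=
  check_mem_check (y := PSet.omega) ⟨ULift.up n, PSet.Equiv.refl _⟩ p

theorem exists_eq_check_of_mem_omega {σ : Name P} {p : P} (h : mem σ omega p) :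
    ∃ r ≤ p, ∃ n : ℕ, eq σ (check (PSet.ofNat n)) r := by
  rw [omega, PSet.omega, check, mem] at h
  obtain ⟨r, hr, j, -, e⟩ := h p le_rfl
  exact ⟨r, hr, j.down, e⟩

theorem check_ofNat_mem {k n : ℕ} (h : k < n) (p : P) :
    mem (check (PSet.ofNat k)) (check (PSet.ofNat n)) p := by
  refine check_mem_check ?_ p
  induction n with
  | zero => omega
  | succ n ih =>
    rw [PSet.ofNat, PSet.mem_insert_iff]
    rcases Nat.lt_succ_iff_lt_or_eq.1 h with h | rfl
    · exact Or.inr (ih h)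
    · exact Or.inl (PSet.Equiv.refl _)

theorem left_mem_upair (σ τ : Name P) (p : P) : mem σ (upair σ τ) p := by
  rw [upair, mem]
  exact fun q _ => ⟨q, le_rfl, true, le_top, eq_refl _ _⟩

theorem right_mem_upair (σ τ : Name P) (p : P) : mem τ (upair σ τ) p := by
  rw [upair, mem]
  exact fun q _ => ⟨q, le_rfl, false, le_top, eq_refl _ _⟩

theorem eq_or_eq_of_mem_upair {ρ σ τ : Name P} {p : P} (h : mem ρ (upair σ τ) p) :
    ∃ r ≤ p, eq ρ σ r ∨ eq ρ τ r := by
  rw [upair, mem] at h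
  obtain ⟨r, hr, j, -, e⟩ := h p le_rfl
  cases j
  · exact ⟨r, hr, Or.inr e⟩
  · exact ⟨r, hr, Or.inl e⟩

theorem eq_of_mem_upair_self {ρ σ : Name P} {p : P} (h : mem ρ (upair σ σ) p) :
    ∃ r ≤ p, eq ρ σ r := by
  obtain ⟨r, hr, e⟩ := eq_or_eq_of_mem_upair h
  exact ⟨r, hr, e.elim id id⟩

theorem upair_congr {σ σ' τ τ' : Name P} {p : P} (h : eq σ σ' p) (h' : eq τ τ' p) :
    eq (upair σ τ) (upair σ' τ') p := by
  rw [upair, upair, eq]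
  constructor <;>
  · rintro (_ | _) q hq -
    · exact ⟨q, le_rfl, false, le_top, eq_mono hq h'⟩
    · exact ⟨q, le_rfl, true, le_top, eq_mono hq h⟩

theorem opair_congr {σ σ' τ τ' : Name P} {p : P} (h : eq σ σ' p) (h' : eq τ τ' p) :
    eq (opair σ τ) (opair σ' τ') p :=
  upair_congr (upair_congr h h) (upair_congr h h')

/-- The usual case analysis for Kuratowski pairs; each disjunction is decided only densely, so every
case distinction passes to a stronger condition. -/
theorem opair_inj {a b c d : Name P} {p : P} (h : eq (opair a b) (opair c d) p) :
    ∃ r ≤ p, eq a c r ∧ eq b d r := by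
  obtain ⟨r₁, h₁, e₁⟩ : ∃ r ≤ p, eq a c r := by
    obtain ⟨r, hr, e | e⟩ :=
      eq_or_eq_of_mem_upair (mem_congr_right h (left_mem_upair (upair a a) (upair a b) p))
    -- Whether `{a}` equals `{c}` or `{c, d}`, it contains `c`.
    all_goals
      obtain ⟨s, hs, e'⟩ :=
        eq_of_mem_upair_self (mem_congr_right (eq_symm e) (left_mem_upair c _ r))
      exact ⟨s, hs.trans hr, eq_symm e'⟩
  suffices ∃ r ≤ r₁, eq b d r by
    obtain ⟨r, hr, e⟩ := this
    exact ⟨r, hr.trans h₁, eq_mono hr e₁, e⟩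
  replace h := eq_mono h₁ h
  obtain ⟨r₂, h₂, e₂⟩ : ∃ r ≤ r₁, eq b c r ∨ eq b d r := by
    obtain ⟨r, hr, e | e⟩ :=
      eq_or_eq_of_mem_upair (mem_congr_right h (right_mem_upair (upair a a) (upair a b) r₁))
    · obtain ⟨s, hs, e'⟩ := eq_of_mem_upair_self (mem_congr_right e (right_mem_upair a b r))
      exact ⟨s, hs.trans hr, Or.inl e'⟩
    · obtain ⟨s, hs, e'⟩ := eq_or_eq_of_mem_upair (mem_congr_right e (right_mem_upair a b r))
      exact ⟨s, hs.trans hr, e'⟩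
  obtain e₂ | e₂ := e₂
  swap
  · exact ⟨r₂, h₂, e₂⟩
  -- In the remaining case `b = c = a`, so `d ∈ {a, b}` gives `b = d` either way.
  obtain ⟨r₃, h₃, e₃⟩ : ∃ r ≤ r₂, eq d a r ∨ eq d b r := by
    obtain ⟨r, hr, e | e⟩ := eq_or_eq_of_mem_upair (mem_congr_right (eq_symm (eq_mono h₂ h))
      (right_mem_upair (upair c c) (upair c d) r₂))
    · obtain ⟨s, hs, e'⟩ := eq_of_mem_upair_self (mem_congr_right e (right_mem_upair c d r))
      exact ⟨s, hs.trans hr, Or.inl e'⟩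
    · obtain ⟨s, hs, e'⟩ := eq_or_eq_of_mem_upair (mem_congr_right e (right_mem_upair c d r))
      exact ⟨s, hs.trans hr, e'⟩
  refine ⟨r₃, h₃.trans h₂, ?_⟩
  obtain e₃ | e₃ := e₃
  · exact eq_trans (eq_mono h₃ e₂)
      (eq_trans (eq_symm (eq_mono (h₃.trans h₂) e₁)) (eq_symm e₃))
  · exact eq_symm e₃

theorem check_singleton_eq (x : PSet.{0}) (p : P) :
    eq (check {x}) (upair (check x) (check x)) p := by
  -- Insertion into a `PSet` adds one index `none`, which points to the new element.
  change eq (.mk (Option PEmpty) (fun o => check (Option.rec _ _ o)) (fun _ => ⊤)) _ p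
  rw [upair, eq]
  refine ⟨?_, ?_⟩
  · rintro (_ | ⟨⟨⟩⟩) q - -
    exact ⟨q, le_rfl, true, le_top, eq_refl _ _⟩
  · rintro (_ | _) q - - <;> exact ⟨q, le_rfl, none, le_top, eq_refl _ _⟩

theorem check_pair_eq (x y : PSet.{0}) (p : P) :
    eq (check {x, y}) (upair (check x) (check y)) p := by
  change eq (.mk (Option (Option PEmpty)) (fun o => check (Option.rec _ _ o)) (fun _ => ⊤)) _ p
  rw [upair, eq]
  refine ⟨?_, ?_⟩
  · rintro (_ | _ | ⟨⟨⟩⟩) q - -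
    · exact ⟨q, le_rfl, true, le_top, eq_refl _ _⟩
    · exact ⟨q, le_rfl, false, le_top, eq_refl _ _⟩
  · rintro (_ | _) q - -
    · exact ⟨q, le_rfl, some none, le_top, eq_refl _ _⟩
    · exact ⟨q, le_rfl, none, le_top, eq_refl _ _⟩

theorem check_kuratowski_eq (x y : PSet.{0}) (p : P) :
    eq (check {{x}, {x, y}}) (opair (check x) (check y)) p :=
  eq_trans (check_pair_eq _ _ p) (upair_congr (check_singleton_eq x p) (check_pair_eq x y p))

theorem exists_of_opair_mem_graph {σ τ : Name P} {g : ℕ → ℕ} {p : P}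
    (h : mem (opair σ τ) (check (graph g)) p) :
    ∃ r ≤ p, ∃ n : ℕ, eq σ (check (PSet.ofNat n)) r ∧ eq τ (check (PSet.ofNat (g n))) r := by
  rw [graph, check, mem] at h
  obtain ⟨r, hr, n, -, e⟩ := h p le_rfl
  obtain ⟨s, hs, e'⟩ := opair_inj (eq_trans e (check_kuratowski_eq _ _ r))
  exact ⟨s, hs.trans hr, n, e'⟩

/-! ### Values of a name for a real -/

theorem isReal.exists_value {x : Name P} {p : P} (h : isReal x p) (n : ℕ) {r : P} (hr : r ≤ p) :
    ∃ s ≤ r, ∃ k : ℕ, mem (opair (check (PSet.ofNat n)) (check (PSet.ofNat k))) x s := by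
  obtain ⟨s, hs, h₁, -⟩ := h.2 _ r hr (check_ofNat_mem_omega n r)
  obtain ⟨t, ht, κ, h₂, h₃⟩ := h₁ s le_rfl
  obtain ⟨u, hu, k, e⟩ := exists_eq_check_of_mem_omega h₂
  exact ⟨u, hu.trans (ht.trans hs), k,
    mem_congr_left (opair_congr (eq_refl _ u) e) (mem_mono hu h₃)⟩

theorem isReal.value_unique {x : Name P} {p : P} (h : isReal x p) (n : ℕ) {κ l : Name P} {r : P}
    (hr : r ≤ p) (hκ : mem κ omega r) (hl : mem l omega r)
    (h₁ : mem (opair (check (PSet.ofNat n)) κ) x r)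
    (h₂ : mem (opair (check (PSet.ofNat n)) l) x r) : ∃ s ≤ r, eq κ l s := by
  obtain ⟨s, hs, -, h₃⟩ := h.2 _ r hr (check_ofNat_mem_omega n r)
  obtain ⟨t, ht, h₄⟩ := h₃ κ s le_rfl (mem_mono hs hκ)
  obtain ⟨u, hu, h₅⟩ := h₄ l t le_rfl (mem_mono (ht.trans hs) hl)
  have hur := hu.trans (ht.trans hs)
  obtain ⟨v, hv, e⟩ := h₅ u le_rfl ⟨mem_mono hur h₁, mem_mono hur h₂⟩
  exact ⟨v, hv.trans hur, e⟩

/-- If `q` forces each value of `x` to be one of finitely many numbers below `g n`, then `q` forces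
`x` to be dominated by `g`. -/
theorem isReal.eventuallyLt_graph {x : Name P} {q : P} (h : isReal x q) {g : ℕ → ℕ}
    (hg : ∀ n, ∀ r ≤ q, ∃ s ≤ r, ∃ k < g n,
      mem (opair (check (PSet.ofNat n)) (check (PSet.ofNat k))) x s) :
    eventuallyLt x (check (graph g)) q := by
  intro q₀ hq₀
  -- The hypothesis bounds every value, so domination already starts at `0`.
  refine ⟨q₀, le_rfl, check (PSet.ofNat 0), check_ofNat_mem_omega 0 q₀, ?_⟩
  intro ν q₁ hq₁ _
  refine ⟨q₁, le_rfl, fun q₂ hq₂ _ => ⟨q₂, le_rfl, ?_⟩⟩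
  intro κ q₃ hq₃ hκ
  refine ⟨q₃, le_rfl, ?_⟩
  intro l q₄ hq₄ _
  refine ⟨q₄, le_rfl, ?_⟩
  rintro q₅ hq₅ ⟨hx, hgr⟩
  obtain ⟨r, hr, n, eν, el⟩ := exists_of_opair_mem_graph hgr
  have hrq : r ≤ q := hr.trans (hq₅.trans (hq₄.trans (hq₃.trans (hq₂.trans (hq₁.trans hq₀)))))
  obtain ⟨s, hs, k, hk, hxk⟩ := hg n r hrq
  have hx' : mem (opair (check (PSet.ofNat n)) κ) x s :=
    mem_mono hs (mem_congr_left (opair_congr eν (eq_refl _ r)) (mem_mono hr hx))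
  obtain ⟨t, ht, e⟩ := h.value_unique n (hs.trans hrq) (check_ofNat_mem_omega k s)
    (mem_mono (hs.trans (hr.trans (hq₅.trans hq₄))) hκ) hxk hx'
  exact ⟨t, ht.trans (hs.trans hr), mem_congr_left e
    (mem_congr_right (eq_symm (eq_mono (ht.trans hs) el)) (check_ofNat_mem hk t))⟩

theorem isReal_mono {x : Name P} {p q : P} (hq : q ≤ p) (h : isReal x p) : isReal x q :=
  ⟨fun σ r hr => h.1 σ r (hr.trans hq), fun σ r hr => h.2 σ r (hr.trans hq)⟩

end CanonicalNames

end Forcing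

/-! ### Fixing the values of finitely many blocks -/

namespace WillowTree

theorem val_mono {p q : WillowTree} (h : q ≤ p) {n : ℕ} {b : Bool} (hb : p.val n = some b) :
    q.val n = some b := h.1 n b hb

theorem val_eq_none {p : WillowTree} {a : Finset ℕ} (ha : a ∈ p.blocks) {n : ℕ} (hn : n ∈ a) :
    p.val n = none := (p.val_eq_none_iff n).2 ⟨a, ha, hn⟩

theorem eq_of_mem_of_mem {p : WillowTree} {a c : Finset ℕ} (ha : a ∈ p.blocks)
    (hc : c ∈ p.blocks) {n : ℕ} (hna : n ∈ a) (hnc : n ∈ c) : a = c := by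
  by_contra hne
  exact Finset.disjoint_left.1 (p.disjoint_blocks ha hc hne) hna hnc

open Classical in
/-- The condition obtained from `p` by giving the value `1` to the blocks in `F ∩ S` and the value
`0` to the blocks in `F \ S`. -/
noncomputable def fix (p : WillowTree) (F S : Finset (Finset ℕ)) (hF : ↑F ⊆ p.blocks) :
    WillowTree where
  blocks := p.blocks \ F
  infinite_blocks := p.infinite_blocks.sdiff F.finite_toSet
  nonempty_of_mem a ha := p.nonempty_of_mem a ha.1
  disjoint_blocks := p.disjoint_blocks.subset Set.sdiff_subset
  val n := if ∃ a ∈ F, n ∈ a then some (decide (∃ a ∈ F, n ∈ a ∧ a ∈ S)) else p.val n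
  val_eq_none_iff n := by
    split_ifs with h
    · obtain ⟨a, ha, hn⟩ := h
      simp only [false_iff, not_exists, not_and]
      intro c hc hnc
      exact hc.2 (eq_of_mem_of_mem (hF ha) hc.1 hn hnc ▸ ha)
    · rw [p.val_eq_none_iff]
      exact ⟨fun ⟨a, ha, hn⟩ => ⟨a, ⟨ha, fun haF => h ⟨a, haF, hn⟩⟩, hn⟩,
        fun ⟨a, ha, hn⟩ => ⟨a, ha.1, hn⟩⟩

variable {p q : WillowTree} {F S : Finset (Finset ℕ)}

theorem fix_val_of_mem (hF : ↑F ⊆ p.blocks) {a : Finset ℕ} (ha : a ∈ F) {n : ℕ} (hn : n ∈ a) :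
    (p.fix F S hF).val n = some (decide (a ∈ S)) := by
  have h : (∃ c ∈ F, n ∈ c ∧ c ∈ S) ↔ a ∈ S :=
    ⟨fun ⟨c, hc, hnc, hcS⟩ => eq_of_mem_of_mem (hF ha) (hF hc) hn hnc ▸ hcS,
      fun h => ⟨a, ha, hn, h⟩⟩
  simp only [fix, if_pos (⟨a, ha, hn⟩ : ∃ a ∈ F, n ∈ a), decide_eq_decide.2 h]

theorem fix_val_of_notMem (hF : ↑F ⊆ p.blocks) {n : ℕ} (hn : ¬∃ a ∈ F, n ∈ a) :
    (p.fix F S hF).val n = p.val n := by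
  simp only [fix, if_neg hn]

/-- Reduces order statements about `fix` to inclusions between sets of branches. -/
theorem mem_branches_fix (hF : ↑F ⊆ p.blocks) {x : ℕ → Bool} :
    x ∈ (p.fix F S hF).branches ↔
      x ∈ p.branches ∧ ∀ a ∈ F, ∀ n ∈ a, x n = decide (a ∈ S) := by
  constructor
  · rintro ⟨h₁, h₂⟩
    have h₃ : ∀ a ∈ F, ∀ n ∈ a, x n = decide (a ∈ S) :=
      fun a ha n hn => h₁ n _ (fix_val_of_mem hF ha hn)
    refine ⟨⟨fun n b hb => h₁ n b ?_, fun a ha m hm n hn => ?_⟩, h₃⟩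
    · rw [fix_val_of_notMem hF, hb]
      rintro ⟨a, ha, hn⟩
      simp [val_eq_none (hF ha) hn] at hb
    · by_cases haF : a ∈ F
      · rw [h₃ a haF m hm, h₃ a haF n hn]
      · exact h₂ a ⟨ha, haF⟩ m hm n hn
  · rintro ⟨⟨h₁, h₂⟩, h₃⟩
    refine ⟨fun n b hb => ?_, fun a ha => h₂ a ha.1⟩
    by_cases h : ∃ a ∈ F, n ∈ a
    · obtain ⟨a, ha, hn⟩ := h
      rw [fix_val_of_mem hF ha hn] at hb
      rw [h₃ a ha n hn, Option.some_inj.1 hb]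
    · rw [fix_val_of_notMem hF h] at hb
      exact h₁ n b hb

theorem fix_le (hF : ↑F ⊆ p.blocks) : p.fix F S hF ≤ p :=
  le_iff_branches_subset.2 fun _ hx => ((mem_branches_fix hF).1 hx).1

theorem fix_mono (hqp : q ≤ p) (hF : ↑F ⊆ p.blocks) (hF' : ↑F ⊆ q.blocks) :
    q.fix F S hF' ≤ p.fix F S hF :=
  le_iff_branches_subset.2 fun _ hx => (mem_branches_fix hF).2
    ⟨le_iff_branches_subset.1 hqp ((mem_branches_fix hF').1 hx).1, ((mem_branches_fix hF').1 hx).2⟩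

open Classical in
/-- A condition below `p.fix F S` extends to one below `p` in which the blocks in `F` are kept. -/
theorem exists_fix_le (hF : ↑F ⊆ p.blocks) (h : q ≤ p.fix F S hF) :
    ∃ r ≤ p, ∃ hr : ↑F ⊆ r.blocks, r.fix F S hr ≤ q := by
  have hval : ∀ a ∈ F, ∀ n ∈ a, q.val n = some (decide (a ∈ S)) :=
    fun a ha n hn => val_mono h (fix_val_of_mem hF ha hn)
  have hdisj : ∀ a ∈ F, ∀ c ∈ q.blocks, Disjoint a c := by
    refine fun a ha c hc => Finset.disjoint_left.2 fun n hn hnc => ?_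
    simpa [val_eq_none hc hnc] using hval a ha n hn
  -- Release the blocks of `F` in `q`. As `q` takes the values prescribed by `S` there, fixing them
  -- again restores `q`.
  let r : WillowTree :=
    { blocks := ↑F ∪ q.blocks
      infinite_blocks := q.infinite_blocks.mono Set.subset_union_right
      nonempty_of_mem := by
        rintro a (ha | ha)
        · exact p.nonempty_of_mem a (hF ha)
        · exact q.nonempty_of_mem a ha
      disjoint_blocks := by
        rintro a (ha | ha) c (hc | hc) hne
        · exact p.disjoint_blocks (hF ha) (hF hc) hne
        · exact hdisj a ha c hc
        · exact (hdisj c hc a ha).symm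
        · exact q.disjoint_blocks ha hc hne
      val := fun n => if ∃ a ∈ F, n ∈ a then none else q.val n
      val_eq_none_iff := by
        intro n
        split_ifs with hn
        · obtain ⟨a, ha, hna⟩ := hn
          exact iff_of_true rfl ⟨a, Or.inl ha, hna⟩
        · rw [q.val_eq_none_iff]
          constructor
          · rintro ⟨a, ha, hna⟩
            exact ⟨a, Or.inr ha, hna⟩
          · rintro ⟨a, ha | ha, hna⟩
            · exact absurd ⟨a, ha, hna⟩ hn
            · exact ⟨a, ha, hna⟩ }
  have hr : ↑F ⊆ r.blocks := Set.subset_union_left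
  have hrval : ∀ n, (¬∃ a ∈ F, n ∈ a) → r.val n = q.val n := fun n hn => if_neg hn
  refine ⟨r, ⟨fun n b hb => ?_, ?_, fun a ha m hm n hn => ?_⟩, hr, ⟨fun n b hb => ?_, ?_, ?_⟩⟩
  · have hn : ¬∃ a ∈ F, n ∈ a := by
      rintro ⟨a, ha, hn⟩
      simp [val_eq_none (hF ha) hn] at hb
    rw [hrval n hn]
    exact val_mono h ((fix_val_of_notMem hF hn).trans hb)
  · rintro a (ha | ha)
    · exact ⟨{a}, by simpa using hF ha, by simp⟩
    · obtain ⟨C, hC, e⟩ := h.2.1 a ha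
      exact ⟨C, hC.trans Set.sdiff_subset, e⟩
  · by_cases haF : a ∈ F
    · rw [val_eq_none (hr haF) hm, val_eq_none (hr haF) hn]
    · have hout : ∀ n ∈ a, ¬∃ c ∈ F, n ∈ c := by
        rintro n hn ⟨c, hc, hnc⟩
        exact haF (eq_of_mem_of_mem ha (hF hc) hn hnc ▸ hc)
      rw [hrval m (hout m hm), hrval n (hout n hn)]
      exact h.2.2 a ⟨ha, haF⟩ m hm n hn
  · by_cases hn : ∃ a ∈ F, n ∈ a
    · obtain ⟨a, ha, hna⟩ := hn
      rw [fix_val_of_mem hr ha hna, ← hval a ha n hna, hb]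
    · rw [fix_val_of_notMem hr hn, hrval n hn, hb]
  · rintro a ⟨ha | ha, haF⟩
    · exact absurd ha haF
    · exact ⟨{a}, by simpa using ha, by simp⟩
  · have hfix : ∀ n, (r.fix F S hr).val n = q.val n := by
      intro n
      by_cases hn : ∃ a ∈ F, n ∈ a
      · obtain ⟨a, ha, hna⟩ := hn
        rw [fix_val_of_mem hr ha hna, hval a ha n hna]
      · rw [fix_val_of_notMem hr hn, hrval n hn]
    intro a ha m hm n hn
    rw [hfix, hfix, val_eq_none ha hm, val_eq_none ha hn]

open Classical in
/-- The conditions `p.fix F S`, for `S ⊆ F`, are predense below `p`. -/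
theorem exists_le_fix (hF : ↑F ⊆ p.blocks) (h : q ≤ p) :
    ∃ S ⊆ F, ∃ r ≤ q, r ≤ p.fix F S hF := by
  let G' : Set (Finset ℕ) := {c | c ∈ q.blocks ∧ ∃ n ∈ F.biUnion id, n ∈ c}
  have hG' : G'.Finite := by
    -- Each point lies in at most one block of `q`, so the blocks meeting the finite set `⋃ F` are
    -- among its images under `β`.
    choose! β hβ hβ' using fun n (hn : q.val n = none) => (q.val_eq_none_iff n).1 hn
    refine ((F.biUnion id).finite_toSet.image β).subset ?_
    rintro c ⟨hc, n, hn, hnc⟩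
    have hv := val_eq_none hc hnc
    exact ⟨n, hn, eq_of_mem_of_mem (hβ n hv) hc (hβ' n hv) hnc⟩
  have hG : ↑hG'.toFinset ⊆ q.blocks := fun c hc => (hG'.mem_toFinset.1 hc).1
  -- The value `0` is arbitrary; what matters is that `r` decides every point of `⋃ F`, so that `S`
  -- can be read off from `r`.
  let r := q.fix hG'.toFinset ∅ hG
  have hrq : r ≤ q := fix_le hG
  have hrF : ∀ a ∈ F, ∀ n ∈ a, r.val n ≠ none := by
    intro a ha n hn hv
    obtain ⟨c, hc, hnc⟩ := (r.val_eq_none_iff n).1 hv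
    exact hc.2 (hG'.mem_toFinset.2 ⟨hc.1, n, Finset.mem_biUnion.2 ⟨a, ha, hn⟩, hnc⟩)
  let T : Finset (Finset ℕ) := {a ∈ F | ∀ n ∈ a, r.val n = some true}
  refine ⟨T, Finset.filter_subset _ _, r, hrq, le_iff_branches_subset.2 fun x hx => ?_⟩
  refine (mem_branches_fix hF).2 ⟨le_iff_branches_subset.1 (hrq.trans h) hx, fun a ha n hn => ?_⟩
  have hconst : ∀ m ∈ a, r.val m = r.val n := fun m hm => (hrq.trans h).2.2 a (hF ha) m hm n hn
  cases hv : r.val n with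
  | none => exact absurd hv (hrF a ha n hn)
  | some b =>
    have hb : a ∈ T ↔ b = true := by
      simp only [T, Finset.mem_filter, ha, true_and]
      refine ⟨fun H => ?_, fun H m hm => by rw [hconst m hm, hv, H]⟩
      simpa [hv] using H n hn
    rw [hx.1 n b hv]
    cases b <;> simp [hb]

/-- A condition can be strengthened, with any finite set of blocks kept, so that every choice of
values on these blocks leads into the dense open set `⋃ k, D k`. -/
theorem exists_forall_fix {D : ℕ → WillowTree → Prop} (hD : ∀ k r s, s ≤ r → D k r → D k s)
    (hdense : ∀ r ≤ p, ∃ s ≤ r, ∃ k, D k s) (hF : ↑F ⊆ p.blocks)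
    (𝒮 : Finset (Finset (Finset ℕ))) :
    ∃ q ≤ p, ∃ hq : ↑F ⊆ q.blocks, ∃ N, ∀ S ∈ 𝒮, ∃ k < N, D k (q.fix F S hq) := by
  classical
  induction 𝒮 using Finset.induction_on with
  | empty => exact ⟨p, le_rfl, hF, 0, by simp⟩
  | insert T 𝒮 _ ih =>
    obtain ⟨q, hqp, hq, N, hN⟩ := ih
    -- Handle the new choice `T` below `q.fix F T`, then release `F`; by openness the earlier
    -- choices stay decided.
    obtain ⟨s, hs, k, hk⟩ := hdense (q.fix F T hq) ((fix_le hq).trans hqp)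
    obtain ⟨r, hrq, hr, hrs⟩ := exists_fix_le hq hs
    refine ⟨r, hrq.trans hqp, hr, max N (k + 1), fun S hS => ?_⟩
    obtain rfl | hS := Finset.mem_insert.1 hS
    · exact ⟨k, by simp, hD _ _ _ hrs hk⟩
    · obtain ⟨j, hj, hDj⟩ := hN S hS
      exact ⟨j, lt_max_of_lt_left hj, hD _ _ _ (fix_mono hrq hq hr) hDj⟩

/-! ### Fusion -/

/-- The growth step of the fusion: a fresh block keeps the growth strict, and the block of `n` (if
any) is kept so that `n` stays free. -/
theorem exists_finset_ssuperset (hF : ↑F ⊆ p.blocks) (n : ℕ) :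
    ∃ G, F ⊂ G ∧ ↑G ⊆ p.blocks ∧ (p.val n = none → ∃ a ∈ G, n ∈ a) := by
  classical
  obtain ⟨c, hc, hcF⟩ := p.infinite_blocks.exists_notMem_finset F
  have hss : F ⊂ insert c F := Finset.ssubset_insert hcF
  have hsub : ↑(insert c F) ⊆ p.blocks := by
    rw [Finset.coe_insert]
    exact Set.insert_subset hc hF
  by_cases hv : p.val n = none
  · obtain ⟨a, ha, hn⟩ := (p.val_eq_none_iff n).1 hv
    refine ⟨insert a (insert c F), hss.trans_subset (Finset.subset_insert _ _), ?_,
      fun _ => ⟨a, Finset.mem_insert_self _ _, hn⟩⟩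
    rw [Finset.coe_insert]
    exact Set.insert_subset ha hsub
  · exact ⟨_, hss, hsub, fun h => absurd h hv⟩

/-- A fusion sequence, in which ever larger finite sets of blocks are kept, has a lower bound. -/
theorem exists_fusion {p : ℕ → WillowTree} {F : ℕ → Finset (Finset ℕ)} (hp : Antitone p)
    (hF : StrictMono F) (hFp : ∀ n, ↑(F n) ⊆ (p n).blocks)
    (hcover : ∀ n, (p n).val n = none → ∃ a ∈ F n, n ∈ a) : ∃ q, ∀ n, q ≤ p n := by
  have hblock : ∀ {j l a}, j ≤ l → a ∈ F j → a ∈ (p l).blocks :=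
    fun hjl ha => hFp _ (hF.monotone hjl ha)
  -- From stage `n` on, the status of the point `n` is frozen, so the limit can be read off
  -- diagonally.
  have hval : ∀ n l, n ≤ l → (p n).val n = (p l).val n := by
    intro n l hnl
    cases hv : (p n).val n with
    | some b => exact (val_mono (hp hnl) hv).symm
    | none =>
      obtain ⟨a, ha, hn⟩ := hcover n hv
      exact (val_eq_none (hblock hnl ha) hn).symm
  let q : WillowTree :=
    { blocks := ⋃ n, ↑(F n)
      infinite_blocks := by
        intro hfin
        -- If the union were finite, the distinct sets `F n` would all lie in its finite power set.
        refine Set.infinite_range_of_injective hF.injective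
          ((hfin.toFinset.powerset.finite_toSet).subset ?_)
        rintro _ ⟨n, rfl⟩
        simp only [Finset.coe_powerset, Set.mem_preimage, Set.mem_powerset_iff,
          Set.Finite.coe_toFinset]
        exact Set.subset_iUnion (fun n => (F n : Set (Finset ℕ))) n
      nonempty_of_mem := by
        intro a ha
        obtain ⟨n, hn⟩ := Set.mem_iUnion.1 ha
        exact (p n).nonempty_of_mem a (hFp n hn)
      disjoint_blocks := by
        intro a ha c hc hne
        obtain ⟨m, hm⟩ := Set.mem_iUnion.1 ha
        obtain ⟨n, hn⟩ := Set.mem_iUnion.1 hc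
        exact (p (max m n)).disjoint_blocks (hblock (le_max_left m n) hm)
          (hblock (le_max_right m n) hn) hne
      val := fun n => (p n).val n
      val_eq_none_iff := by
        intro n
        constructor
        · intro hv
          obtain ⟨a, ha, hn⟩ := hcover n hv
          exact ⟨a, Set.mem_iUnion.2 ⟨n, ha⟩, hn⟩
        · rintro ⟨a, ha, hn⟩
          obtain ⟨j, hj⟩ := Set.mem_iUnion.1 ha
          rw [hval n (max j n) (le_max_right j n)]
          exact val_eq_none (hblock (le_max_left j n) hj) hn }
  refine ⟨q, fun k => ⟨fun n b hb => ?_, fun a ha => ?_, fun a ha m hm n hn => ?_⟩⟩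
  · change (p n).val n = some b
    rw [hval n (max k n) (le_max_right k n)]
    exact val_mono (hp (le_max_left k n)) hb
  · obtain ⟨j, hj⟩ := Set.mem_iUnion.1 ha
    exact (hp (le_max_right j k)).2.1 a (hblock (le_max_left j k) hj)
  · change (p m).val m = (p n).val n
    -- `k + m + n` is a common stage past `k`, `m` and `n`.
    rw [hval m (k + m + n) (by omega), hval n (k + m + n) (by omega)]
    exact (hp (by omega : k ≤ k + m + n)).2.2 a ha m hm n hn

/-- Given countably many dense open sets `⋃ k, D n k`, there is a condition `q ≤ p` below which, for
each `n`, finitely many of the sets `D n k` suffice. -/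
theorem exists_bound {D : ℕ → ℕ → WillowTree → Prop}
    (hD : ∀ n k r s, s ≤ r → D n k r → D n k s)
    (hdense : ∀ n, ∀ r ≤ p, ∃ s ≤ r, ∃ k, D n k s) :
    ∃ q ≤ p, ∃ g : ℕ → ℕ, ∀ n, ∀ r ≤ q, ∃ s ≤ r, ∃ k < g n, D n k s := by
  let State (n : ℕ) : Type := {s : WillowTree × Finset (Finset ℕ) //
    s.1 ≤ p ∧ ↑s.2 ⊆ s.1.blocks ∧ (s.1.val n = none → ∃ a ∈ s.2, n ∈ a)}
  have hstep : ∀ n (s : State n), ∃ t : State (n + 1), t.1.1 ≤ s.1.1 ∧ s.1.2 ⊂ t.1.2 ∧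
      ∃ N, ∀ r ≤ t.1.1, ∃ u ≤ r, ∃ k < N, D n k u := by
    rintro n ⟨⟨p', F⟩, hp', hF, -⟩
    obtain ⟨q, hq, hFq, N, hN⟩ := exists_forall_fix (hD n)
      (fun r hr => hdense n r (hr.trans hp')) hF F.powerset
    obtain ⟨G, hFG, hG, hcover⟩ := exists_finset_ssuperset hFq (n + 1)
    refine ⟨⟨(q, G), hq.trans hp', hG, hcover⟩, hq, hFG, N, fun r hr => ?_⟩
    obtain ⟨S, hS, u, hu, hu'⟩ := exists_le_fix hFq hr
    obtain ⟨k, hk, hDk⟩ := hN S (Finset.mem_powerset.2 hS)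
    exact ⟨u, hu, k, hk, hD _ _ _ _ hu' hDk⟩
  choose next hle hss g hg using hstep
  obtain ⟨F₀, -, hF₀, hcover₀⟩ := exists_finset_ssuperset (p := p) (F := ∅) (by simp) 0
  let seq : ∀ n, State n := fun n =>
    Nat.rec (motive := State) ⟨(p, F₀), le_rfl, hF₀, hcover₀⟩ next n
  obtain ⟨q, hq⟩ := exists_fusion (p := fun n => (seq n).1.1) (F := fun n => (seq n).1.2)
    (antitone_nat_of_succ_le fun n => hle n (seq n))
    (strictMono_nat_of_lt_succ fun n => hss n (seq n))
    (fun n => (seq n).2.2.1) (fun n => (seq n).2.2.2)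
  -- The bound for `n` holds below stage `n + 1`, hence the use of `hq (n + 1)`.
  exact ⟨q, hq 0, fun n => g n (seq n), fun n r hr => hg n (seq n) r (hr.trans (hq (n + 1)))⟩

end WillowTree

theorem mainTheorem7 : Forcing.OmegaOmegaBounding WillowTree := by
  intro p x hx
  -- `D n k` is the open set of conditions forcing `x(n) = k`; density of the union over `k` is
  -- `isReal.exists_value`.
  obtain ⟨q, hq, g, hg⟩ := WillowTree.exists_bound (p := p)
    (D := fun n k => Forcing.mem
      (Forcing.opair (Forcing.check (PSet.ofNat n)) (Forcing.check (PSet.ofNat k))) x)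
    (fun _ _ _ _ hs h => Forcing.mem_mono hs h) (fun n _ hr => hx.exists_value n hr)
  exact ⟨q, hq, g, (Forcing.isReal_mono hq hx).eventuallyLt_graph hg⟩
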